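/- Let $p\ge 1$ be an integer. For $\theta\in[-\pi,\pi]$ put $$M_p(\theta)=(2-2\cos\theta)^{p+1}\sum_{j\in\mathbb Z}\frac{1}{(\theta+2j\pi)^{2p+2}},\qquad B_p(\theta)=-(2-2\cos\theta)^{p+1}\sum_{j\in\mathbb Z}\frac{1}{(\theta+2j\pi)^{2p}},\qquad D_p(\theta)=(-1)^p(2-2\cos\theta)^p,$$ where at the removable singularity $\theta=0$ the limit values $M_p(0)=1$ and $B_p(0)=0$ are taken; the same formulas extend these functions $2\pi$-periodically and smoothly to $\mathbb R$, and derivatives are those of the extensions. Let $$F_p(\theta;\rho,\delta)=B_p(\theta)+\rho\bigl(M_p(\theta)+\delta(-1)^pD_p(\theta)\bigr),\qquad \delta_p=-\frac{M_p(\pi)}{(-1)^pD_p(\pi)},\qquad \rho_p=-\frac{B_p(\pi)}{M_p(\pi)}.$$ Then the following hold. 1. For every $\delta\in\mathbb R$: the function $\theta\mapsto F_p(\theta;\rho,\delta)$ has, for all $\rho>0$, exactly two zeros in $[-\pi,\pi]$, both of them simple, if and only if $\delta\le\delta_p$. 2. For every $\rho>0$: the function $\theta\mapsto F_p(\theta;\rho,0)$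 has exactly two distinct zeros in $[-\pi,\pi]$ if and only if $\rho\le\rho_p$; and it has exactly two zeros in $[-\pi,\pi]$, both of them simple, if and only if $\rho<\rho_p$. In the borderline case $\rho=\rho_p$ the zeros in $[-\pi,\pi]$ are exactly $\theta=\pm\pi$ (the same point of the circle $\mathbb R/2\pi\mathbb Z$), and there the first derivative of $F_p(\cdot;\rho_p,0)$ vanishes and the second does not. 3. For all $\rho>0$ and $\delta\le0$, the function $\theta\mapsto F_p(\theta;\rho,\delta)/M_p(\theta)$ is strictly decreasing on $(0,\pi)$. -/

import Mathlib

noncomputable section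

namespace SplineSymbol

/-- `M_p(θ) = (2 - 2 cos θ)^(p+1) ∑_{j ∈ ℤ} 1 / (θ + 2 j π)^(2p+2)`, with the limit value `1` at the
removable singularities `θ ∈ 2πℤ` (in `[-π, π]` this is only `θ = 0`). -/
def M (p : ℕ) (θ : ℝ) : ℝ :=
  if Real.cos θ = 1 then 1
  else (2 - 2 * Real.cos θ) ^ (p + 1) *
    ∑' j : ℤ, 1 / (θ + 2 * (j : ℝ) * Real.pi) ^ (2 * p + 2)

/-- `B_p(θ) = -(2 - 2 cos θ)^(p+1) ∑_{j ∈ ℤ} 1 / (θ + 2 j π)^(2p)`, with the limit value `0` at the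
removable singularities `θ ∈ 2πℤ`. -/
def B (p : ℕ) (θ : ℝ) : ℝ :=
  if Real.cos θ = 1 then 0
  else -((2 - 2 * Real.cos θ) ^ (p + 1) *
    ∑' j : ℤ, 1 / (θ + 2 * (j : ℝ) * Real.pi) ^ (2 * p))

/-- `D_p(θ) = (-1)^p (2 - 2 cos θ)^p`. -/
def D (p : ℕ) (θ : ℝ) : ℝ :=
  (-1) ^ p * (2 - 2 * Real.cos θ) ^ p

/-- `F_p(θ; ρ, δ) = B_p(θ) + ρ (M_p(θ) + δ (-1)^p D_p(θ))`. -/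
def F (p : ℕ) (ρ δ θ : ℝ) : ℝ :=
  B p θ + ρ * (M p θ + δ * (-1) ^ p * D p θ)

/-- `δ_p = - M_p(π) / ((-1)^p D_p(π))`. -/
def deltaCrit (p : ℕ) : ℝ :=
  -(M p Real.pi / ((-1) ^ p * D p Real.pi))

/-- `ρ_p = - B_p(π) / M_p(π)`. -/
def rhoCrit (p : ℕ) : ℝ :=
  -(B p Real.pi / M p Real.pi)

/-- The set of zeros of `f` in `[-π, π]`. -/
def zerosOn (f : ℝ → ℝ) : Set ℝ :=
  {θ | θ ∈ Set.Icc (-Real.pi) Real.pi ∧ f θ = 0}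

/-- `f` has exactly two distinct zeros in `[-π, π]`. -/
def HasExactlyTwoZeros (f : ℝ → ℝ) : Prop :=
  (zerosOn f).encard = 2

/-- `f` has exactly two zeros in `[-π, π]`, and both are simple. -/
def HasExactlyTwoSimpleZeros (f : ℝ → ℝ) : Prop :=
  HasExactlyTwoZeros f ∧ ∀ θ ∈ zerosOn f, deriv f θ ≠ 0

end SplineSymbol

end

/-!
Write `L_n(θ) = ∑ j, (θ + 2jπ)^(-n)` and `w = 2 - 2 cos θ`. Parseval's identity for
`x ↦ exp (-iθx)` on `(0, 1)` gives `w L_2 = 1`, that is, `M_0 = 1`. Put `q_p = -B_p / M_p` and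
`Q_p = (-1)^p D_p / M_p`, so that `F_p / M_p = ρ + ρ δ Q_p - q_p`, `ρ_p = q_p(π)` and
`δ_p = -1 / Q_p(π)`.

Away from `2πℤ` we have `q_p = L_{2p} / L_{2p+2}`, whose derivative is a positive multiple of
`W = (p + 1) L_{2p} L_{2p+3} - p L_{2p+1} L_{2p+2}`. The odd sums vanish at `π`, so `W(π) = 0`,
while `W' < 0` by the Cauchy-Schwarz inequality `L_{2p+2}^2 ≤ L_{2p} L_{2p+4}`. Hence `q_p` is
strictly increasing on `[0, π]`, and `q_p''(π) < 0`. Since `B_{p+1} = -w M_p`, we have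
`Q_{p+1} = Q_p q_{p+1}` with `Q_0 = 1`, so every `Q_p` is nondecreasing. For `δ ≤ 0` the even
function `F_p / M_p` therefore decreases strictly from `ρ` at `0`, and its sign at `π` decides
the number of zeros. At `π` itself the derivative of `F_p` vanishes because `F_p` is even and
`2π`-periodic.
-/

namespace SplineSymbol

open Real Set Filter Topology

/-! ### Derivatives and zeros of even functions -/

lemma apply_abs_of_even {α β : Type*} [AddGroup α] [LinearOrder α] {f : α → β} (heven : f.Even)
    (x : α) : f |x| = f x := by
  rcases abs_choice x with h | h <;> rw [h]
  exact heven x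

section EvenDerivatives

variable {E : Type*} [NormedAddCommGroup E] [NormedSpace ℝ E] {f : ℝ → E}

lemma deriv_neg_of_even (heven : f.Even) (x : ℝ) : deriv f (-x) = -deriv f x := by
  have h := deriv_comp_neg f x
  rw [funext heven] at h
  rw [h, neg_neg]

lemma deriv_eq_zero_of_even_of_periodic {c : ℝ} (heven : f.Even)
    (hper : f.Periodic (2 * c)) : deriv f c = 0 := by
  have hsymm : (fun x => f (2 * c - x)) = f := by
    funext x
    rw [sub_eq_neg_add, hper, heven]
  have h := deriv_comp_const_sub f (2 * c) c
  rw [hsymm, two_mul, add_sub_cancel_right] at h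
  exact (smul_eq_zero_iff_right (two_ne_zero (α := ℝ))).1
    ((two_smul ℝ _).trans (eq_neg_iff_add_eq_zero.1 h))

lemma iteratedDeriv_neg_of_even (n : ℕ) (heven : f.Even) (x : ℝ) :
    iteratedDeriv n f (-x) = (-1 : ℝ) ^ n • iteratedDeriv n f x := by
  have h := iteratedDeriv_comp_neg n f (-x)
  rwa [funext heven, neg_neg] at h

end EvenDerivatives

section EvenFunctions

variable {f : ℝ → ℝ}

lemma zerosOn_eq_pair (heven : f.Even) (hinj : InjOn f (Icc 0 π)) {a : ℝ}
    (ha : a ∈ Icc 0 π) (hfa : f a = 0) : zerosOn f = {-a, a} := by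
  ext θ
  calc θ ∈ zerosOn f ↔ |θ| ∈ Icc 0 π ∧ f |θ| = f a := by
        rw [apply_abs_of_even heven, hfa, mem_Icc, and_iff_right (abs_nonneg θ), abs_le]
        rfl
    _ ↔ |θ| = a :=
        ⟨fun h => hinj h.1 ha h.2, fun h => h ▸ ⟨h.symm ▸ ha, rfl⟩⟩
    _ ↔ θ ∈ ({-a, a} : Set ℝ) := by rw [abs_eq ha.1, or_comm]; rfl

lemma exists_zerosOn_eq_pair (heven : f.Even) (hanti : StrictAntiOn f (Icc 0 π))
    (hcont : ContinuousOn f (Icc 0 π)) (h0 : 0 < f 0) (hπ : f π ≤ 0) :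
    ∃ a ∈ Ioc 0 π, f a = 0 ∧ zerosOn f = {-a, a} := by
  obtain ⟨a, ha, hfa⟩ := intermediate_value_Ioc' pi_nonneg hcont ⟨hπ, h0⟩
  exact ⟨a, ha, hfa, zerosOn_eq_pair heven hanti.injOn (Ioc_subset_Icc_self ha) hfa⟩

lemma hasExactlyTwoZeros_iff (heven : f.Even) (hanti : StrictAntiOn f (Icc 0 π))
    (hcont : ContinuousOn f (Icc 0 π)) (h0 : 0 < f 0) : HasExactlyTwoZeros f ↔ f π ≤ 0 := by
  constructor
  · intro h
    obtain ⟨x, hx, hfx⟩ : (zerosOn f).Nonempty := by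
      rw [← encard_ne_zero, h]
      exact two_ne_zero
    have hx' : |x| ≤ π := abs_le.2 hx
    calc f π ≤ f |x| :=
          hanti.antitoneOn ⟨abs_nonneg x, hx'⟩ (right_mem_Icc.2 pi_nonneg) hx'
      _ = 0 := by rw [apply_abs_of_even heven, hfx]
  · intro hπ
    obtain ⟨a, ha, -, hpair⟩ := exists_zerosOn_eq_pair heven hanti hcont h0 hπ
    rw [HasExactlyTwoZeros, hpair]
    exact encard_pair (neg_lt_self ha.1).ne

end EvenFunctions

section ProductDerivatives

variable {𝕜 𝔸 : Type*} [NontriviallyNormedField 𝕜] [NormedRing 𝔸] [NormedAlgebra 𝕜 𝔸]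
  {u v : 𝕜 → 𝔸} {x : 𝕜}

lemma deriv_mul_of_apply_eq_zero (hu : DifferentiableAt 𝕜 u x) (hv : DifferentiableAt 𝕜 v x)
    (h0 : v x = 0) : deriv (u * v) x = u x * deriv v x := by
  rw [deriv_mul hu hv, h0, mul_zero, zero_add]

lemma iteratedDeriv_two_mul_of_apply_eq_zero (hu : ContDiffAt 𝕜 2 u x) (hv : ContDiffAt 𝕜 2 v x)
    (h0 : v x = 0) (h1 : deriv v x = 0) :
    iteratedDeriv 2 (u * v) x = u x * iteratedDeriv 2 v x := by
  simp [iteratedDeriv_mul hu hv, Finset.sum_range_succ, h0, h1]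

end ProductDerivatives

/-! ### Lattice sums -/

/-- The lattice sum `∑_{j ∈ ℤ} 1 / (θ + 2 j π)^n`. -/
noncomputable def latticeSum (n : ℕ) (θ : ℝ) : ℝ :=
  ∑' j : ℤ, 1 / (θ + 2 * (j : ℝ) * π) ^ n

lemma cos_add_two_mul_int_mul_pi (θ : ℝ) (j : ℤ) : cos (θ + 2 * j * π) = cos θ := by
  rw [← cos_add_int_mul_two_pi θ j]
  ring_nf

lemma two_sub_two_cos_nonneg (θ : ℝ) : 0 ≤ 2 - 2 * cos θ := by
  linarith [cos_le_one θ]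

lemma two_sub_two_cos_pos {θ : ℝ} (h : cos θ ≠ 1) : 0 < 2 - 2 * cos θ := by
  linarith [(cos_le_one θ).lt_of_ne h]

lemma two_sub_two_cos_le_sq (θ : ℝ) (j : ℤ) : 2 - 2 * cos θ ≤ (θ + 2 * j * π) ^ 2 := by
  have := one_sub_sq_div_two_le_cos (x := θ + 2 * j * π)
  rw [cos_add_two_mul_int_mul_pi] at this
  linarith

lemma add_two_mul_int_mul_pi_ne_zero {θ : ℝ} (h : cos θ ≠ 1) (j : ℤ) : θ + 2 * j * π ≠ 0 := by
  intro h0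
  rw [← cos_add_two_mul_int_mul_pi θ j, h0, cos_zero] at h
  exact h rfl

lemma isOpen_cos_ne_one : IsOpen {θ : ℝ | cos θ ≠ 1} :=
  isOpen_ne.preimage continuous_cos

lemma summable_one_div_add_pow {n : ℕ} (hn : 2 ≤ n) (θ : ℝ) :
    Summable fun j : ℤ => 1 / (θ + 2 * (j : ℝ) * π) ^ n := by
  refine .of_norm ?_
  have h : Summable fun j : ℤ => 1 / |j + θ / (2 * π)| ^ (n : ℝ) :=
    (summable_one_div_int_add_rpow _ _).2 (by exact_mod_cast hn)
  refine (h.mul_left (1 / (2 * π) ^ n)).congr fun j => ?_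
  have : |θ + 2 * j * π| = 2 * π * |j + θ / (2 * π)| := by
    rw [← abs_of_pos two_pi_pos, ← abs_mul, abs_of_pos two_pi_pos]
    field_simp
    ring_nf
  rw [rpow_natCast, norm_div, norm_one, norm_pow, norm_eq_abs, this, mul_pow _ |_|,
    one_div_mul_one_div]

lemma hasDerivAt_one_div_add_pow {𝕜 : Type*} [NontriviallyNormedField 𝕜] (n : ℕ) {θ c : 𝕜}
    (h : θ + c ≠ 0) :
    HasDerivAt (fun x => 1 / (x + c) ^ n) (-n * (1 / (θ + c) ^ (n + 1))) θ := by
  have h1 := (hasDerivAt_zpow (-n) (θ + c) (.inl h)).comp_add_const θ c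
  have e (x : 𝕜) : x ^ (-(n : ℤ)) = 1 / x ^ n := by simp
  have e' (x : 𝕜) : x ^ (-(n : ℤ) - 1) = 1 / x ^ (n + 1) := by
    rw [← neg_add', ← Nat.cast_succ, zpow_neg, zpow_natCast, one_div]
  simpa only [e, e', Int.cast_neg, Int.cast_natCast] using h1

lemma norm_one_div_add_pow_le {x y r : ℝ} (hy : 2 * r ≤ |y|) (hr : 0 < r) (hx : |x - y| < r)
    (n : ℕ) : ‖1 / x ^ n‖ ≤ 2 ^ n * ‖1 / y ^ n‖ := by
  have hxy : |y| / 2 ≤ |x| := by linarith [abs_sub_abs_le_abs_sub y x, abs_sub_comm x y]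
  have hpos : 0 < |y| / 2 := by linarith
  calc ‖1 / x ^ n‖ = 1 / |x| ^ n := by rw [norm_div, norm_one, norm_pow, norm_eq_abs]
    _ ≤ 1 / (|y| / 2) ^ n := by gcongr
    _ = 2 ^ n * ‖1 / y ^ n‖ := by
      rw [div_pow, one_div_div, norm_div, norm_one, norm_pow, norm_eq_abs, mul_one_div]

lemma hasDerivAt_latticeSum {n : ℕ} (hn : 2 ≤ n) {θ : ℝ} (h : cos θ ≠ 1) :
    HasDerivAt (latticeSum n) (-n * latticeSum (n + 1) θ) θ := by
  -- Every pole is at distance at least `2 r` from `θ`, so on the ball of radius `r` the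
  -- differentiated series is dominated by a multiple of its value at `θ`.
  set r := √(2 - 2 * cos θ) / 2 with hr
  have hr0 : 0 < r := half_pos (sqrt_pos.2 (two_sub_two_cos_pos h))
  have hle (j : ℤ) : 2 * r ≤ |θ + 2 * (j : ℝ) * π| := by
    rw [hr, mul_div_cancel₀ _ two_ne_zero, ← sqrt_sq_eq_abs]
    exact sqrt_le_sqrt (two_sub_two_cos_le_sq θ j)
  have hclose {x : ℝ} (hx : x ∈ Metric.ball θ r) (j : ℤ) :
      |x + 2 * (j : ℝ) * π - (θ + 2 * (j : ℝ) * π)| < r := by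
    rwa [add_sub_add_right_eq_sub, ← dist_eq]
  have hne {x : ℝ} (hx : x ∈ Metric.ball θ r) (j : ℤ) : x + 2 * (j : ℝ) * π ≠ 0 := by
    intro h0
    have := hclose hx j
    rw [h0, zero_sub, abs_neg] at this
    linarith [hle j]
  have hderiv := hasDerivAt_tsum_of_isPreconnected
    (((summable_one_div_add_pow (by lia : 2 ≤ n + 1) θ).norm.mul_left (2 ^ (n + 1))).mul_left
      (n : ℝ))
    Metric.isOpen_ball (convex_ball θ r).isPreconnected
    (fun j x hx => hasDerivAt_one_div_add_pow n (hne hx j))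
    (fun j x hx => by
      rw [norm_mul, norm_neg, norm_natCast]
      gcongr
      exact norm_one_div_add_pow_le (hle j) hr0 (hclose hx j) (n + 1))
    (Metric.mem_ball_self hr0) (summable_one_div_add_pow hn θ) (Metric.mem_ball_self hr0)
  rwa [tsum_mul_left] at hderiv

lemma contDiffAt_latticeSum {n : ℕ} (hn : 2 ≤ n) (m : ℕ) {θ : ℝ} (h : cos θ ≠ 1) :
    ContDiffAt ℝ m (latticeSum n) θ := by
  suffices ContDiffOn ℝ m (latticeSum n) {x | cos x ≠ 1} from
    this.contDiffAt (isOpen_cos_ne_one.mem_nhds h)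
  clear h
  induction m generalizing n with
  | zero =>
    exact contDiffOn_zero.2 fun x hx =>
      (hasDerivAt_latticeSum hn hx).continuousAt.continuousWithinAt
  | succ m ih =>
    push_cast
    refine (contDiffOn_succ_iff_deriv_of_isOpen isOpen_cos_ne_one).2
      ⟨fun x hx => (hasDerivAt_latticeSum hn hx).differentiableAt.differentiableWithinAt,
        by simp, ?_⟩
    exact (contDiffOn_const.mul (ih (by lia : 2 ≤ n + 1))).congr
      fun x hx => (hasDerivAt_latticeSum hn hx).deriv

lemma norm_exp_I_mul_sub_one_sq (θ : ℝ) :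
    ‖Complex.exp (Complex.I * θ) - 1‖ ^ 2 = 2 - 2 * cos θ := by
  rw [Complex.norm_exp_I_mul_ofReal_sub_one, norm_eq_abs, sq_abs, mul_pow, sin_sq_eq_half_sub,
    mul_div_cancel₀ θ two_ne_zero]
  ring

lemma norm_fourierCoeffOn_exp_sq {θ : ℝ} (h : cos θ ≠ 1) (j : ℤ) :
    ‖fourierCoeffOn zero_lt_one (fun x : ℝ => Complex.exp (-(Complex.I * θ * x))) j‖ ^ 2 =
      (2 - 2 * cos θ) * (1 / (θ + 2 * j * π) ^ 2) := by
  set y : ℝ := θ + 2 * j * π with hy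
  have hy0 : y ≠ 0 := add_two_mul_int_mul_pi_ne_zero h j
  have hI : -(Complex.I * y) ≠ 0 := by simpa using hy0
  have hintegrand (x : ℝ) : fourier (-j) (x : AddCircle ((1 : ℝ) - 0)) •
      Complex.exp (-(Complex.I * θ * x)) = Complex.exp (-(Complex.I * y) * x) := by
    rw [fourier_coe_apply, smul_eq_mul, ← Complex.exp_add, hy]
    push_cast
    ring_nf
  rw [fourierCoeffOn_eq_integral]
  simp_rw [hintegrand]
  rw [integral_exp_mul_complex hI]
  have hnum : Complex.exp (-(Complex.I * y) * (1 : ℝ)) - Complex.exp (-(Complex.I * y) * (0 : ℝ)) =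
      Complex.exp (Complex.I * (-y : ℝ)) - 1 := by
    simp
  have hnorm : ‖-(Complex.I * y)‖ = |y| := by simp
  rw [hnum, sub_zero, div_one, one_smul, norm_div, div_pow, norm_exp_I_mul_sub_one_sq, hnorm,
    sq_abs, cos_neg, hy, cos_add_two_mul_int_mul_pi, mul_one_div]

lemma latticeSum_two {θ : ℝ} (h : cos θ ≠ 1) : latticeSum 2 θ = 1 / (2 - 2 * cos θ) := by
  have hL2 : MeasureTheory.MemLp (fun x : ℝ => Complex.exp (-(Complex.I * θ * x))) 2
      (MeasureTheory.volume.restrict (Ioc 0 1)) := by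
    refine .of_bound (by fun_prop) 1 (.of_forall fun x => ?_)
    simp [Complex.norm_exp]
  have hparseval := tsum_sq_fourierCoeffOn zero_lt_one hL2
  simp_rw [norm_fourierCoeffOn_exp_sq h] at hparseval
  rw [tsum_mul_left] at hparseval
  rw [eq_div_iff (two_sub_two_cos_pos h).ne', mul_comm]
  simpa [Complex.norm_exp, latticeSum] using hparseval

lemma latticeSum_periodic (n : ℕ) : Function.Periodic (latticeSum n) (2 * π) := by
  intro θ
  unfold latticeSum
  rw [← (Equiv.addRight (1 : ℤ)).tsum_eq fun j : ℤ => 1 / (θ + 2 * (j : ℝ) * π) ^ n]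
  refine tsum_congr fun j => ?_
  simp only [Equiv.coe_addRight, Int.cast_add, Int.cast_one]
  ring_nf

lemma latticeSum_neg (n : ℕ) (θ : ℝ) : latticeSum n (-θ) = (-1) ^ n * latticeSum n θ := by
  unfold latticeSum
  rw [← (Equiv.neg ℤ).tsum_eq, ← tsum_mul_left]
  refine tsum_congr fun j => ?_
  have hshift : -θ + 2 * ((Equiv.neg ℤ j : ℤ) : ℝ) * π = -1 * (θ + 2 * j * π) := by
    simp only [Equiv.neg_apply, Int.cast_neg]
    ring
  rw [hshift, mul_pow, ← one_div_mul_one_div, ← one_div_pow, one_div_neg_one_eq_neg_one]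

lemma latticeSum_even {n : ℕ} (hn : Even n) : Function.Even (latticeSum n) := fun θ => by
  rw [latticeSum_neg, hn.neg_one_pow, one_mul]

lemma latticeSum_odd_pi {n : ℕ} (hn : Odd n) : latticeSum n π = 0 := by
  have h : latticeSum n π = -latticeSum n π := by
    nth_rw 1 [show π = -π + 2 * π by ring]
    rw [latticeSum_periodic, latticeSum_neg, hn.neg_one_pow, neg_one_mul]
  linarith

lemma one_div_pow_le_latticeSum {n : ℕ} (hn : Even n) (hn2 : 2 ≤ n) (θ : ℝ) :
    1 / θ ^ n ≤ latticeSum n θ := by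
  have h := (summable_one_div_add_pow hn2 θ).le_tsum 0
    fun j _ => one_div_nonneg.2 (hn.pow_nonneg _)
  simpa [latticeSum] using h

lemma latticeSum_pos {n : ℕ} (hn : Even n) (hn2 : 2 ≤ n) {θ : ℝ} (h : cos θ ≠ 1) :
    0 < latticeSum n θ := by
  have h0 : θ ≠ 0 := by rintro rfl; exact h cos_zero
  exact (one_div_pos.2 (hn.pow_pos h0)).trans_le (one_div_pow_le_latticeSum hn hn2 θ)

lemma latticeSum_add_sq_le {a b : ℕ} (ha : 1 ≤ a) (hb : 1 ≤ b) (θ : ℝ) :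
    latticeSum (a + b) θ ^ 2 ≤ latticeSum (2 * a) θ * latticeSum (2 * b) θ := by
  have hquad (t : ℝ) : 0 ≤ latticeSum (2 * a) θ * (t * t) +
      2 * latticeSum (a + b) θ * t + latticeSum (2 * b) θ := by
    have h1 := (summable_one_div_add_pow (by lia : 2 ≤ 2 * a) θ).mul_right (t * t)
    have h2 := ((summable_one_div_add_pow (by lia : 2 ≤ a + b) θ).mul_left 2).mul_right t
    have h3 := summable_one_div_add_pow (by lia : 2 ≤ 2 * b) θ
    unfold latticeSum
    rw [← tsum_mul_right, ← tsum_mul_left, ← tsum_mul_right, ← h1.tsum_add h2,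
      ← (h1.add h2).tsum_add h3]
    refine tsum_nonneg fun j => ?_
    convert sq_nonneg (1 / (θ + 2 * (j : ℝ) * π) ^ a * t + 1 / (θ + 2 * (j : ℝ) * π) ^ b) using 1
    simp only [one_div, ← inv_pow]
    ring
  have := discrim_le_zero hquad
  rw [discrim] at this
  linarith

/-- Half the numerator of the derivative of `latticeSum (2 * k) / latticeSum (2 * k + 2)`. -/
noncomputable def latticeWronskian (k : ℕ) (θ : ℝ) : ℝ :=
  (k + 1) * (latticeSum (2 * k) θ * latticeSum (2 * k + 3) θ) -
    k * (latticeSum (2 * k + 1) θ * latticeSum (2 * k + 2) θ)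

lemma latticeWronskian_pi (k : ℕ) : latticeWronskian k π = 0 := by
  rw [latticeWronskian, latticeSum_odd_pi (odd_two_mul_add_one k),
    latticeSum_odd_pi (by grind : Odd (2 * k + 3))]
  ring

lemma hasDerivAt_latticeWronskian {k : ℕ} (hk : 1 ≤ k) {θ : ℝ} (h : cos θ ≠ 1) :
    HasDerivAt (latticeWronskian k)
      (k * (2 * k + 1) * latticeSum (2 * k + 2) θ ^ 2 -
        (k + 1) * (2 * k + 3) * (latticeSum (2 * k) θ * latticeSum (2 * k + 4) θ)) θ := by
  have h0 := hasDerivAt_latticeSum (by lia : 2 ≤ 2 * k) h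
  have h1 := hasDerivAt_latticeSum (by lia : 2 ≤ 2 * k + 1) h
  have h2 := hasDerivAt_latticeSum (by lia : 2 ≤ 2 * k + 2) h
  have h3 := hasDerivAt_latticeSum (by lia : 2 ≤ 2 * k + 3) h
  refine (((h0.mul h3).const_mul ((k : ℝ) + 1)).sub
    ((h1.mul h2).const_mul (k : ℝ))).congr_deriv ?_
  push_cast
  ring

lemma deriv_latticeWronskian_neg {k : ℕ} (hk : 1 ≤ k) {θ : ℝ} (h : cos θ ≠ 1) :
    deriv (latticeWronskian k) θ < 0 := by
  rw [(hasDerivAt_latticeWronskian hk h).deriv, sub_neg]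
  have hcs : latticeSum (2 * k + 2) θ ^ 2 ≤ latticeSum (2 * k) θ * latticeSum (2 * k + 4) θ := by
    convert latticeSum_add_sq_le hk (by lia : 1 ≤ k + 2) θ using 3 <;> lia
  have hpos : 0 < latticeSum (2 * k) θ * latticeSum (2 * k + 4) θ :=
    mul_pos (latticeSum_pos (by grind) (by lia) h) (latticeSum_pos (by grind) (by lia) h)
  calc k * (2 * k + 1) * latticeSum (2 * k + 2) θ ^ 2
      ≤ k * (2 * k + 1) * (latticeSum (2 * k) θ * latticeSum (2 * k + 4) θ) := by gcongr
    _ < (k + 1) * (2 * k + 3) * (latticeSum (2 * k) θ * latticeSum (2 * k + 4) θ) := by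
      gcongr <;> linarith

lemma cos_ne_one_of_mem_Ioc {θ : ℝ} (h : θ ∈ Ioc 0 π) : cos θ ≠ 1 := fun h1 =>
  h.1.ne' <| (cos_eq_one_iff_of_lt_of_lt (by linarith [h.1, pi_pos])
    (by linarith [h.2, pi_pos])).1 h1

lemma latticeWronskian_pos {k : ℕ} (hk : 1 ≤ k) {θ : ℝ} (h : θ ∈ Ioo 0 π) :
    0 < latticeWronskian k θ := by
  have hanti : StrictAntiOn (latticeWronskian k) (Ioc 0 π) := by
    refine strictAntiOn_of_deriv_neg (convex_Ioc 0 π) (fun x hx => ?_) fun x hx => ?_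
    · exact (hasDerivAt_latticeWronskian hk
        (cos_ne_one_of_mem_Ioc hx)).continuousAt.continuousWithinAt
    · exact deriv_latticeWronskian_neg hk (cos_ne_one_of_mem_Ioc (interior_subset hx))
  rw [← latticeWronskian_pi k]
  exact hanti (Ioo_subset_Ioc_self h) (right_mem_Ioc.2 pi_pos) h.2

/-! ### The quotients of the symbols -/

lemma neg_one_pow_mul_D (p : ℕ) (θ : ℝ) : (-1) ^ p * D p θ = (2 - 2 * cos θ) ^ p := by
  rw [D, ← mul_assoc, ← mul_pow, neg_one_mul, neg_neg, one_pow, one_mul]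

lemma M_eq_of_cos_ne_one (p : ℕ) {θ : ℝ} (h : cos θ ≠ 1) :
    M p θ = (2 - 2 * cos θ) ^ (p + 1) * latticeSum (2 * p + 2) θ :=
  if_neg h

lemma B_eq_of_cos_ne_one (p : ℕ) {θ : ℝ} (h : cos θ ≠ 1) :
    B p θ = -((2 - 2 * cos θ) ^ (p + 1) * latticeSum (2 * p) θ) :=
  if_neg h

lemma M_zero (θ : ℝ) : M 0 θ = 1 := by
  by_cases h : cos θ = 1
  · exact if_pos h
  · rw [M_eq_of_cos_ne_one 0 h, zero_add, pow_one, mul_zero, zero_add, latticeSum_two h,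
      mul_one_div_cancel (two_sub_two_cos_pos h).ne']

lemma B_succ (p : ℕ) (θ : ℝ) : B (p + 1) θ = -((2 - 2 * cos θ) * M p θ) := by
  by_cases h : cos θ = 1
  · simp [B, h]
  · rw [B_eq_of_cos_ne_one _ h, M_eq_of_cos_ne_one _ h, pow_succ' _ (p + 1), mul_assoc]
    rfl

lemma M_pos (p : ℕ) (θ : ℝ) : 0 < M p θ := by
  by_cases h : cos θ = 1
  · simp [M, h]
  · rw [M_eq_of_cos_ne_one p h]
    exact mul_pos (pow_pos (two_sub_two_cos_pos h) _) (latticeSum_pos (by grind) (by lia) h)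

lemma M_le_one (p : ℕ) (θ : ℝ) : M p θ ≤ 1 := by
  by_cases h : cos θ = 1
  · simp [M, h]
  have hterm (j : ℤ) : (2 - 2 * cos θ) ^ p * (1 / (θ + 2 * j * π) ^ (2 * p + 2)) ≤
      1 / (θ + 2 * j * π) ^ 2 := by
    have hx := add_two_mul_int_mul_pi_ne_zero h j
    calc (2 - 2 * cos θ) ^ p * (1 / (θ + 2 * j * π) ^ (2 * p + 2))
        ≤ ((θ + 2 * j * π) ^ 2) ^ p * (1 / (θ + 2 * j * π) ^ (2 * p + 2)) := by
          have : 0 ≤ 1 / (θ + 2 * j * π) ^ (2 * p + 2) :=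
            one_div_nonneg.2 (Even.pow_nonneg (by grind) _)
          gcongr
          · exact two_sub_two_cos_nonneg θ
          · exact two_sub_two_cos_le_sq θ j
      _ = 1 / (θ + 2 * j * π) ^ 2 := by
          rw [pow_add, ← pow_mul]
          field_simp
  have hsum : (2 - 2 * cos θ) ^ p * latticeSum (2 * p + 2) θ ≤ latticeSum 2 θ := by
    unfold latticeSum
    rw [← tsum_mul_left]
    exact ((summable_one_div_add_pow (by lia) θ).mul_left _).tsum_le_tsum hterm
      (summable_one_div_add_pow le_rfl θ)
  calc M p θ = (2 - 2 * cos θ) * ((2 - 2 * cos θ) ^ p * latticeSum (2 * p + 2) θ) := by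
        rw [M_eq_of_cos_ne_one p h, pow_succ', mul_assoc]
    _ ≤ (2 - 2 * cos θ) * latticeSum 2 θ := by
        gcongr
        exact two_sub_two_cos_nonneg θ
    _ = 1 := by rw [latticeSum_two h, mul_one_div_cancel (two_sub_two_cos_pos h).ne']

lemma le_M_of_abs_le_pi (p : ℕ) {θ : ℝ} (hθ : |θ| ≤ π) : (4 / π ^ 2) ^ (p + 1) ≤ M p θ := by
  by_cases h : cos θ = 1
  · have : 4 / π ^ 2 ≤ 1 := (div_le_one (by positivity)).2 (by nlinarith [two_le_pi])
    simpa [M, h] using pow_le_one₀ (by positivity) this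
  have h0 : 0 < θ ^ 2 := by
    have : θ ≠ 0 := by rintro rfl; exact h cos_zero
    positivity
  have hw : 4 / π ^ 2 * θ ^ 2 ≤ 2 - 2 * cos θ := by
    have : 4 / π ^ 2 * θ ^ 2 = 2 * (2 / π ^ 2 * θ ^ 2) := by ring
    linarith [cos_le_one_sub_mul_cos_sq hθ]
  have hL := one_div_pow_le_latticeSum (by grind : Even (2 * p + 2)) (by lia) θ
  calc (4 / π ^ 2) ^ (p + 1) = (4 / π ^ 2 * θ ^ 2) ^ (p + 1) * (1 / θ ^ (2 * p + 2)) := by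
        rw [mul_pow, ← pow_mul, mul_assoc, show 2 * (p + 1) = 2 * p + 2 by ring,
          mul_one_div_cancel (pow_ne_zero _ (pow_ne_zero_iff two_ne_zero |>.1 h0.ne')), mul_one]
    _ ≤ (2 - 2 * cos θ) ^ (p + 1) * latticeSum (2 * p + 2) θ := by
        have := pow_nonneg (two_sub_two_cos_nonneg θ) (p + 1)
        have : 0 ≤ 1 / θ ^ (2 * p + 2) := one_div_nonneg.2 (Even.pow_nonneg (by grind) θ)
        gcongr
    _ = M p θ := (M_eq_of_cos_ne_one p h).symm

/-- The quotient `-B_p / M_p`, whose value at `π` is `ρ_p`. -/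
noncomputable def stiffnessRatio (p : ℕ) (θ : ℝ) : ℝ :=
  -(B p θ / M p θ)

/-- The quotient `(-1)^p D_p / M_p`, whose value at `π` is `-1 / δ_p`. -/
noncomputable def penaltyRatio (p : ℕ) (θ : ℝ) : ℝ :=
  (-1) ^ p * D p θ / M p θ

/-- The quotient `F_p / M_p`, which has the same zeros as `F_p`. -/
noncomputable def normalizedF (p : ℕ) (ρ δ θ : ℝ) : ℝ :=
  F p ρ δ θ / M p θ

lemma stiffnessRatio_succ (p : ℕ) (θ : ℝ) :
    stiffnessRatio (p + 1) θ = (2 - 2 * cos θ) * M p θ / M (p + 1) θ := by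
  rw [stiffnessRatio, B_succ, neg_div, neg_neg]

lemma stiffnessRatio_eq_of_cos_ne_one (p : ℕ) {θ : ℝ} (h : cos θ ≠ 1) :
    stiffnessRatio p θ = latticeSum (2 * p) θ / latticeSum (2 * p + 2) θ := by
  rw [stiffnessRatio, M_eq_of_cos_ne_one p h, B_eq_of_cos_ne_one p h, neg_div, neg_neg,
    mul_div_mul_left _ _ (pow_pos (two_sub_two_cos_pos h) _).ne']

lemma stiffnessRatio_of_cos_eq_one (p : ℕ) {θ : ℝ} (h : cos θ = 1) : stiffnessRatio p θ = 0 := by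
  simp [stiffnessRatio, B, h]

lemma stiffnessRatio_eventuallyEq (p : ℕ) {θ : ℝ} (h : cos θ ≠ 1) :
    stiffnessRatio p =ᶠ[𝓝 θ] fun x => latticeSum (2 * p) x / latticeSum (2 * p + 2) x := by
  filter_upwards [isOpen_cos_ne_one.mem_nhds h] with x hx
    using stiffnessRatio_eq_of_cos_ne_one p hx

lemma stiffnessRatio_nonneg {p : ℕ} (hp : 1 ≤ p) (θ : ℝ) : 0 ≤ stiffnessRatio p θ := by
  obtain ⟨p, rfl⟩ := Nat.exists_eq_add_of_le' hp
  rw [stiffnessRatio_succ]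
  exact div_nonneg (mul_nonneg (two_sub_two_cos_nonneg θ) (M_pos p θ).le) (M_pos (p + 1) θ).le

lemma stiffnessRatio_le {p : ℕ} (hp : 1 ≤ p) {θ : ℝ} (hθ : |θ| ≤ π) :
    stiffnessRatio p θ ≤ (2 - 2 * cos θ) / (4 / π ^ 2) ^ (p + 1) := by
  obtain ⟨p, rfl⟩ := Nat.exists_eq_add_of_le' hp
  rw [stiffnessRatio_succ]
  exact div_le_div₀ (two_sub_two_cos_nonneg θ)
    (mul_le_of_le_one_right (two_sub_two_cos_nonneg θ) (M_le_one p θ)) (by positivity)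
    (le_M_of_abs_le_pi (p + 1) hθ)

lemma contDiffAt_stiffnessRatio {p : ℕ} (hp : 1 ≤ p) (m : ℕ) {θ : ℝ} (h : cos θ ≠ 1) :
    ContDiffAt ℝ m (stiffnessRatio p) θ :=
  ((contDiffAt_latticeSum (by lia) m h).div (contDiffAt_latticeSum (by lia) m h)
    (latticeSum_pos (by grind) (by lia) h).ne').congr_of_eventuallyEq
    (stiffnessRatio_eventuallyEq p h)

lemma hasDerivAt_stiffnessRatio {p : ℕ} (hp : 1 ≤ p) {θ : ℝ} (h : cos θ ≠ 1) :
    HasDerivAt (stiffnessRatio p)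
      (2 * latticeWronskian p θ / latticeSum (2 * p + 2) θ ^ 2) θ := by
  refine (((hasDerivAt_latticeSum (by lia) h).div (hasDerivAt_latticeSum (by lia) h)
    (latticeSum_pos (by grind) (by lia) h).ne').congr_deriv ?_).congr_of_eventuallyEq
    (stiffnessRatio_eventuallyEq p h)
  rw [latticeWronskian]
  push_cast
  ring

lemma iteratedDeriv_two_stiffnessRatio_pi_neg {p : ℕ} (hp : 1 ≤ p) :
    iteratedDeriv 2 (stiffnessRatio p) π < 0 := by
  have hπ : cos π ≠ 1 := cos_ne_one_of_mem_Ioc (right_mem_Ioc.2 pi_pos)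
  have hL := latticeSum_pos (by grind : Even (2 * p + 2)) (by lia) hπ
  have hderiv : deriv (stiffnessRatio p) =ᶠ[𝓝 π]
      fun x => 2 * latticeWronskian p x / latticeSum (2 * p + 2) x ^ 2 := by
    filter_upwards [isOpen_cos_ne_one.mem_nhds hπ] with x hx
      using (hasDerivAt_stiffnessRatio hp hx).deriv
  have hW := (hasDerivAt_latticeWronskian hp hπ).differentiableAt.hasDerivAt
  have hquot := (hW.const_mul 2).div ((hasDerivAt_latticeSum (by lia) hπ).pow 2)
    (pow_pos hL 2).ne'
  rw [iteratedDeriv_succ, iteratedDeriv_one, hderiv.deriv_eq]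
  refine hquot.deriv.trans_lt ?_
  rw [latticeWronskian_pi, mul_zero, zero_mul, sub_zero]
  exact div_neg_of_neg_of_pos
    (mul_neg_of_neg_of_pos (by linarith [deriv_latticeWronskian_neg hp hπ]) (pow_pos hL 2))
    (pow_pos (pow_pos hL 2) 2)

lemma continuousOn_stiffnessRatio {p : ℕ} (hp : 1 ≤ p) :
    ContinuousOn (stiffnessRatio p) (Icc 0 π) := by
  intro θ hθ
  rcases hθ.1.eq_or_lt with rfl | h0
  · have hupper : Tendsto (fun x => (2 - 2 * cos x) / (4 / π ^ 2) ^ (p + 1)) (𝓝[Icc 0 π] 0)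
        (𝓝 0) := by
      have hc : Continuous fun x => (2 - 2 * cos x) / (4 / π ^ 2) ^ (p + 1) := by fun_prop
      simpa using (hc.tendsto 0).mono_left nhdsWithin_le_nhds
    rw [ContinuousWithinAt, stiffnessRatio_of_cos_eq_one p cos_zero]
    refine squeeze_zero' (.of_forall (stiffnessRatio_nonneg hp)) ?_ hupper
    filter_upwards [self_mem_nhdsWithin] with x hx
    exact stiffnessRatio_le hp ((abs_of_nonneg hx.1).trans_le hx.2)
  · exact (hasDerivAt_stiffnessRatio hp
      (cos_ne_one_of_mem_Ioc ⟨h0, hθ.2⟩)).continuousAt.continuousWithinAt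

lemma deriv_stiffnessRatio_pos {p : ℕ} (hp : 1 ≤ p) {θ : ℝ} (hθ : θ ∈ Ioo 0 π) :
    0 < deriv (stiffnessRatio p) θ := by
  have h := cos_ne_one_of_mem_Ioc (Ioo_subset_Ioc_self hθ)
  rw [(hasDerivAt_stiffnessRatio hp h).deriv]
  have := latticeWronskian_pos hp hθ
  have := latticeSum_pos (by grind : Even (2 * p + 2)) (by lia) h
  positivity

lemma strictMonoOn_stiffnessRatio {p : ℕ} (hp : 1 ≤ p) :
    StrictMonoOn (stiffnessRatio p) (Icc 0 π) :=
  strictMonoOn_of_deriv_pos (convex_Icc 0 π) (continuousOn_stiffnessRatio hp) fun _ hθ =>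
    deriv_stiffnessRatio_pos hp (by rwa [interior_Icc] at hθ)

lemma penaltyRatio_zero (θ : ℝ) : penaltyRatio 0 θ = 1 := by
  simp [penaltyRatio, D, M_zero]

lemma penaltyRatio_succ (p : ℕ) (θ : ℝ) :
    penaltyRatio (p + 1) θ = penaltyRatio p θ * stiffnessRatio (p + 1) θ := by
  rw [stiffnessRatio_succ, penaltyRatio, penaltyRatio, neg_one_pow_mul_D, neg_one_pow_mul_D]
  rw [div_mul_div_comm, ← mul_assoc, ← pow_succ, mul_comm (M p θ),
    mul_div_mul_right _ _ (M_pos p θ).ne']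

lemma penaltyRatio_nonneg (p : ℕ) (θ : ℝ) : 0 ≤ penaltyRatio p θ := by
  rw [penaltyRatio, neg_one_pow_mul_D]
  exact div_nonneg (pow_nonneg (two_sub_two_cos_nonneg θ) p) (M_pos p θ).le

lemma continuousOn_penaltyRatio (p : ℕ) : ContinuousOn (penaltyRatio p) (Icc 0 π) := by
  induction p with
  | zero => exact continuousOn_const.congr fun θ _ => penaltyRatio_zero θ
  | succ p ih =>
    exact (ih.mul (continuousOn_stiffnessRatio (by lia))).congr fun θ _ => penaltyRatio_succ p θ

lemma differentiableAt_penaltyRatio (p : ℕ) {θ : ℝ} (h : cos θ ≠ 1) :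
    DifferentiableAt ℝ (penaltyRatio p) θ := by
  induction p with
  | zero => exact (differentiableAt_const 1).congr_of_eventuallyEq (.of_forall penaltyRatio_zero)
  | succ p ih =>
    exact (ih.mul (hasDerivAt_stiffnessRatio (by lia) h).differentiableAt).congr_of_eventuallyEq
      (.of_forall (penaltyRatio_succ p))

lemma monotoneOn_penaltyRatio (p : ℕ) : MonotoneOn (penaltyRatio p) (Icc 0 π) := by
  induction p with
  | zero => exact monotoneOn_const.congr fun θ _ => (penaltyRatio_zero θ).symm
  | succ p ih =>
    exact (ih.mul (strictMonoOn_stiffnessRatio (by lia)).monotoneOn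
      (fun θ _ => penaltyRatio_nonneg p θ)
      fun θ _ => stiffnessRatio_nonneg (by lia) θ).congr fun θ _ => (penaltyRatio_succ p θ).symm

lemma deriv_penaltyRatio_nonneg (p : ℕ) {θ : ℝ} (hθ : θ ∈ Ioo 0 π) :
    0 ≤ deriv (penaltyRatio p) θ := by
  rw [← derivWithin_of_mem_nhds (Icc_mem_nhds hθ.1 hθ.2)]
  exact (monotoneOn_penaltyRatio p).derivWithin_nonneg

lemma penaltyRatio_pi_pos (p : ℕ) : 0 < penaltyRatio p π := by
  rw [penaltyRatio, neg_one_pow_mul_D, cos_pi]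
  exact div_pos (by norm_num) (M_pos p π)

lemma normalizedF_eq (p : ℕ) (ρ δ : ℝ) :
    normalizedF p ρ δ = fun θ => ρ + ρ * δ * penaltyRatio p θ - stiffnessRatio p θ := by
  funext θ
  have := (M_pos p θ).ne'
  rw [normalizedF, F, penaltyRatio, stiffnessRatio]
  field_simp
  ring

lemma normalizedF_delta_zero (p : ℕ) (ρ : ℝ) :
    normalizedF p ρ 0 = fun θ => ρ - stiffnessRatio p θ := by
  simp only [normalizedF_eq, mul_zero, zero_mul, add_zero]

lemma continuousOn_normalizedF {p : ℕ} (hp : 1 ≤ p) (ρ δ : ℝ) :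
    ContinuousOn (normalizedF p ρ δ) (Icc 0 π) := by
  rw [normalizedF_eq]
  exact (continuousOn_const.add (continuousOn_const.mul (continuousOn_penaltyRatio p))).sub
    (continuousOn_stiffnessRatio hp)

lemma normalizedF_at_zero {p : ℕ} (hp : 1 ≤ p) (ρ δ : ℝ) : normalizedF p ρ δ 0 = ρ := by
  simp [normalizedF, F, M, B, D, Nat.one_le_iff_ne_zero.1 hp]

lemma strictAntiOn_normalizedF {p : ℕ} (hp : 1 ≤ p) {ρ δ : ℝ} (h : ρ * δ ≤ 0) :
    StrictAntiOn (normalizedF p ρ δ) (Icc 0 π) := by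
  intro x hx y hy hxy
  simp only [normalizedF_eq]
  have hQ := mul_le_mul_of_nonpos_left (monotoneOn_penaltyRatio p hx hy hxy.le) h
  linarith [strictMonoOn_stiffnessRatio hp hx hy hxy]

lemma hasDerivAt_normalizedF {p : ℕ} (hp : 1 ≤ p) (ρ δ : ℝ) {θ : ℝ} (h : cos θ ≠ 1) :
    HasDerivAt (normalizedF p ρ δ)
      (ρ * δ * deriv (penaltyRatio p) θ - deriv (stiffnessRatio p) θ) θ := by
  rw [normalizedF_eq]
  exact (((differentiableAt_penaltyRatio p h).hasDerivAt.const_mul (ρ * δ)).const_add ρ).sub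
    (hasDerivAt_stiffnessRatio hp h).differentiableAt.hasDerivAt

lemma deriv_normalizedF_neg {p : ℕ} (hp : 1 ≤ p) {ρ δ : ℝ} (h : ρ * δ ≤ 0) {θ : ℝ}
    (hθ : θ ∈ Ioo 0 π) : deriv (normalizedF p ρ δ) θ < 0 := by
  rw [(hasDerivAt_normalizedF hp ρ δ (cos_ne_one_of_mem_Ioc (Ioo_subset_Ioc_self hθ))).deriv]
  linarith [mul_nonpos_of_nonpos_of_nonneg h (deriv_penaltyRatio_nonneg p hθ),
    deriv_stiffnessRatio_pos hp hθ]

lemma contDiffAt_M (p m : ℕ) {θ : ℝ} (h : cos θ ≠ 1) : ContDiffAt ℝ m (M p) θ := by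
  have hL := contDiffAt_latticeSum (by lia : 2 ≤ 2 * p + 2) m h
  have hw : ContDiffAt ℝ m (fun x => (2 - 2 * cos x) ^ (p + 1)) θ := by fun_prop
  refine (hw.mul hL).congr_of_eventuallyEq ?_
  filter_upwards [isOpen_cos_ne_one.mem_nhds h] with x hx using M_eq_of_cos_ne_one p hx

lemma M_even (p : ℕ) : Function.Even (M p) := fun θ => by
  have := latticeSum_even (by grind : Even (2 * p + 2)) θ
  unfold latticeSum at this
  rw [M, M, cos_neg, this]

lemma B_even (p : ℕ) : Function.Even (B p) := fun θ => by
  have := latticeSum_even (even_two_mul p) θ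
  unfold latticeSum at this
  rw [B, B, cos_neg, this]

lemma M_periodic (p : ℕ) : Function.Periodic (M p) (2 * π) := fun θ => by
  have := latticeSum_periodic (2 * p + 2) θ
  unfold latticeSum at this
  rw [M, M, cos_add_two_pi, this]

lemma B_periodic (p : ℕ) : Function.Periodic (B p) (2 * π) := fun θ => by
  have := latticeSum_periodic (2 * p) θ
  unfold latticeSum at this
  rw [B, B, cos_add_two_pi, this]

lemma F_even (p : ℕ) (ρ δ : ℝ) : Function.Even (F p ρ δ) := fun θ => by
  rw [F, F, B_even, M_even, D, D, cos_neg]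

lemma F_periodic (p : ℕ) (ρ δ : ℝ) : Function.Periodic (F p ρ δ) (2 * π) := fun θ => by
  rw [F, F, B_periodic, M_periodic, D, D, cos_add_two_pi]

/-! ### Zeros of the symbol -/

lemma F_eq_M_mul_normalizedF (p : ℕ) (ρ δ : ℝ) : F p ρ δ = M p * normalizedF p ρ δ := by
  funext θ
  exact (mul_div_cancel₀ _ (M_pos p θ).ne').symm

lemma normalizedF_eq_zero_iff {p : ℕ} {ρ δ θ : ℝ} : normalizedF p ρ δ θ = 0 ↔ F p ρ δ θ = 0 := by
  rw [normalizedF, div_eq_zero_iff, or_iff_left (M_pos p θ).ne']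

lemma zerosOn_F (p : ℕ) (ρ δ : ℝ) : zerosOn (F p ρ δ) = zerosOn (normalizedF p ρ δ) := by
  simp only [zerosOn, normalizedF_eq_zero_iff]

lemma normalizedF_even (p : ℕ) (ρ δ : ℝ) : Function.Even (normalizedF p ρ δ) := fun θ => by
  rw [normalizedF, normalizedF, F_even, M_even]

lemma deriv_F_pi (p : ℕ) (ρ δ : ℝ) : deriv (F p ρ δ) π = 0 :=
  deriv_eq_zero_of_even_of_periodic (F_even p ρ δ) (F_periodic p ρ δ)

lemma deriv_F_of_normalizedF_eq_zero {p : ℕ} (hp : 1 ≤ p) {ρ δ θ : ℝ} (h : cos θ ≠ 1)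
    (h0 : normalizedF p ρ δ θ = 0) :
    deriv (F p ρ δ) θ = M p θ * deriv (normalizedF p ρ δ) θ := by
  rw [F_eq_M_mul_normalizedF]
  exact deriv_mul_of_apply_eq_zero ((contDiffAt_M p 1 h).differentiableAt one_ne_zero)
    (hasDerivAt_normalizedF hp ρ δ h).differentiableAt h0

lemma hasExactlyTwoZeros_F_iff {p : ℕ} (hp : 1 ≤ p) {ρ δ : ℝ} (hρ : 0 < ρ) (hδ : δ ≤ 0) :
    HasExactlyTwoZeros (F p ρ δ) ↔ normalizedF p ρ δ π ≤ 0 := by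
  rw [HasExactlyTwoZeros, zerosOn_F]
  exact hasExactlyTwoZeros_iff (normalizedF_even p ρ δ)
    (strictAntiOn_normalizedF hp (mul_nonpos_of_nonneg_of_nonpos hρ.le hδ))
    (continuousOn_normalizedF hp ρ δ) (by rwa [normalizedF_at_zero hp])

lemma not_hasExactlyTwoSimpleZeros_F {p : ℕ} {ρ δ : ℝ} (h : normalizedF p ρ δ π = 0) :
    ¬HasExactlyTwoSimpleZeros (F p ρ δ) := fun hF =>
  hF.2 π ⟨right_mem_Icc.2 (by linarith [pi_pos]), normalizedF_eq_zero_iff.1 h⟩ (deriv_F_pi p ρ δ)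

lemma deriv_F_ne_zero {p : ℕ} (hp : 1 ≤ p) {ρ δ : ℝ} (h : ρ * δ ≤ 0) {a : ℝ}
    (ha : a ∈ Ioo 0 π) (h0 : normalizedF p ρ δ a = 0) : deriv (F p ρ δ) a ≠ 0 := by
  rw [deriv_F_of_normalizedF_eq_zero hp (cos_ne_one_of_mem_Ioc (Ioo_subset_Ioc_self ha)) h0]
  exact (mul_neg_of_pos_of_neg (M_pos p a) (deriv_normalizedF_neg hp h ha)).ne

lemma hasExactlyTwoSimpleZeros_F_iff {p : ℕ} (hp : 1 ≤ p) {ρ δ : ℝ} (hρ : 0 < ρ) (hδ : δ ≤ 0) :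
    HasExactlyTwoSimpleZeros (F p ρ δ) ↔ normalizedF p ρ δ π < 0 := by
  refine ⟨fun h => ((hasExactlyTwoZeros_F_iff hp hρ hδ).1 h.1).lt_of_ne fun h0 =>
    not_hasExactlyTwoSimpleZeros_F h0 h, fun hπ => ?_⟩
  refine ⟨(hasExactlyTwoZeros_F_iff hp hρ hδ).2 hπ.le, ?_⟩
  have hρδ : ρ * δ ≤ 0 := mul_nonpos_of_nonneg_of_nonpos hρ.le hδ
  obtain ⟨a, ha, h0, hpair⟩ := exists_zerosOn_eq_pair (normalizedF_even p ρ δ)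
    (strictAntiOn_normalizedF hp hρδ) (continuousOn_normalizedF hp ρ δ)
    (by rwa [normalizedF_at_zero hp]) hπ.le
  have haπ : a < π := ha.2.lt_of_ne (by rintro rfl; exact hπ.ne h0)
  have hsimple := deriv_F_ne_zero hp hρδ ⟨ha.1, haπ⟩ h0
  rw [zerosOn_F, hpair]
  rintro θ (rfl | rfl)
  · rw [deriv_neg_of_even (F_even p ρ δ)]
    exact neg_ne_zero.2 hsimple
  · exact hsimple

lemma rhoCrit_eq (p : ℕ) : rhoCrit p = stiffnessRatio p π :=
  rfl

lemma normalizedF_pi (p : ℕ) (ρ δ : ℝ) :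
    normalizedF p ρ δ π = ρ * (1 + δ * penaltyRatio p π) - rhoCrit p := by
  rw [normalizedF_eq, rhoCrit_eq]
  ring

lemma rhoCrit_pos {p : ℕ} (hp : 1 ≤ p) : 0 < rhoCrit p :=
  calc 0 = stiffnessRatio p 0 := (stiffnessRatio_of_cos_eq_one p cos_zero).symm
    _ < stiffnessRatio p π := strictMonoOn_stiffnessRatio hp (left_mem_Icc.2 pi_nonneg)
      (right_mem_Icc.2 pi_nonneg) pi_pos

lemma deltaCrit_eq (p : ℕ) : deltaCrit p = -1 / penaltyRatio p π := by
  rw [deltaCrit, penaltyRatio, neg_div, one_div_div]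

lemma le_deltaCrit_iff {p : ℕ} {δ : ℝ} : δ ≤ deltaCrit p ↔ 1 + δ * penaltyRatio p π ≤ 0 := by
  rw [deltaCrit_eq, le_div_iff₀ (penaltyRatio_pi_pos p), le_neg_iff_add_nonpos_left]

lemma deltaCrit_neg (p : ℕ) : deltaCrit p < 0 := by
  rw [deltaCrit_eq]
  exact div_neg_of_neg_of_pos neg_one_lt_zero (penaltyRatio_pi_pos p)

lemma forall_hasExactlyTwoSimpleZeros_F_iff {p : ℕ} (hp : 1 ≤ p) (δ : ℝ) :
    (∀ ρ : ℝ, 0 < ρ → HasExactlyTwoSimpleZeros (F p ρ δ)) ↔ δ ≤ deltaCrit p := by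
  constructor
  · intro h
    by_contra hlt
    rw [le_deltaCrit_iff, not_le] at hlt
    -- This choice of `ρ` puts a zero at `π`, where symmetry forces it to be multiple.
    refine not_hasExactlyTwoSimpleZeros_F ?_
      (h (rhoCrit p / (1 + δ * penaltyRatio p π)) (div_pos (rhoCrit_pos hp) hlt))
    rw [normalizedF_pi, div_mul_cancel₀ _ hlt.ne', sub_self]
  · intro hδ ρ hρ
    rw [hasExactlyTwoSimpleZeros_F_iff hp hρ (hδ.trans (deltaCrit_neg p).le), normalizedF_pi]
    linarith [mul_nonpos_of_nonneg_of_nonpos hρ.le (le_deltaCrit_iff.1 hδ), rhoCrit_pos hp]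

lemma normalizedF_delta_zero_pi (p : ℕ) (ρ : ℝ) : normalizedF p ρ 0 π = ρ - rhoCrit p := by
  rw [normalizedF_pi, zero_mul, add_zero, mul_one]

lemma hasExactlyTwoZeros_F_iff_le_rhoCrit {p : ℕ} (hp : 1 ≤ p) {ρ : ℝ} (hρ : 0 < ρ) :
    HasExactlyTwoZeros (F p ρ 0) ↔ ρ ≤ rhoCrit p := by
  rw [hasExactlyTwoZeros_F_iff hp hρ le_rfl, normalizedF_delta_zero_pi, sub_nonpos]

lemma hasExactlyTwoSimpleZeros_F_iff_lt_rhoCrit {p : ℕ} (hp : 1 ≤ p) {ρ : ℝ} (hρ : 0 < ρ) :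
    HasExactlyTwoSimpleZeros (F p ρ 0) ↔ ρ < rhoCrit p := by
  rw [hasExactlyTwoSimpleZeros_F_iff hp hρ le_rfl, normalizedF_delta_zero_pi, sub_neg]

lemma zerosOn_F_rhoCrit {p : ℕ} (hp : 1 ≤ p) : zerosOn (F p (rhoCrit p) 0) = {-π, π} := by
  rw [zerosOn_F]
  exact zerosOn_eq_pair (normalizedF_even p _ 0) (strictAntiOn_normalizedF hp (mul_zero _).le).injOn
    (right_mem_Icc.2 pi_nonneg) (by rw [normalizedF_delta_zero_pi, sub_self])

lemma iteratedDeriv_two_F_rhoCrit_pi_pos {p : ℕ} (hp : 1 ≤ p) :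
    0 < iteratedDeriv 2 (F p (rhoCrit p) 0) π := by
  have hπ : cos π ≠ 1 := cos_ne_one_of_mem_Ioc (right_mem_Ioc.2 pi_pos)
  have hq : deriv (stiffnessRatio p) π = 0 := by
    rw [(hasDerivAt_stiffnessRatio hp hπ).deriv, latticeWronskian_pi, mul_zero, zero_div]
  rw [F_eq_M_mul_normalizedF, normalizedF_delta_zero, iteratedDeriv_two_mul_of_apply_eq_zero
    (contDiffAt_M p 2 hπ) (contDiffAt_const.sub (contDiffAt_stiffnessRatio hp 2 hπ))
    (by rw [rhoCrit_eq, sub_self]) (by rw [deriv_const_sub, hq, neg_zero]),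
    iteratedDeriv_const_sub two_pos, iteratedDeriv_neg]
  exact mul_pos (M_pos p π) (neg_pos.2 (iteratedDeriv_two_stiffnessRatio_pi_neg hp))

end SplineSymbol

theorem lemma5p9 (p : ℕ) (hp : 1 ≤ p) :
    (∀ δ : ℝ,
      (∀ ρ : ℝ, 0 < ρ → SplineSymbol.HasExactlyTwoSimpleZeros (SplineSymbol.F p ρ δ)) ↔
        δ ≤ SplineSymbol.deltaCrit p) ∧
    (∀ ρ : ℝ, 0 < ρ →
      (SplineSymbol.HasExactlyTwoZeros (SplineSymbol.F p ρ 0) ↔ ρ ≤ SplineSymbol.rhoCrit p) ∧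
      (SplineSymbol.HasExactlyTwoSimpleZeros (SplineSymbol.F p ρ 0) ↔
        ρ < SplineSymbol.rhoCrit p)) ∧
    (SplineSymbol.zerosOn (SplineSymbol.F p (SplineSymbol.rhoCrit p) 0) =
        {-Real.pi, Real.pi} ∧
      ∀ θ ∈ ({-Real.pi, Real.pi} : Set ℝ),
        deriv (SplineSymbol.F p (SplineSymbol.rhoCrit p) 0) θ = 0 ∧
        iteratedDeriv 2 (SplineSymbol.F p (SplineSymbol.rhoCrit p) 0) θ ≠ 0) ∧
    (∀ ρ δ : ℝ, 0 < ρ → δ ≤ 0 →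
      StrictAntiOn (fun θ => SplineSymbol.F p ρ δ θ / SplineSymbol.M p θ)
        (Set.Ioo 0 Real.pi)) := by
  refine ⟨SplineSymbol.forall_hasExactlyTwoSimpleZeros_F_iff hp, fun ρ hρ =>
    ⟨SplineSymbol.hasExactlyTwoZeros_F_iff_le_rhoCrit hp hρ,
      SplineSymbol.hasExactlyTwoSimpleZeros_F_iff_lt_rhoCrit hp hρ⟩,
    ⟨SplineSymbol.zerosOn_F_rhoCrit hp, ?_⟩, fun ρ δ hρ hδ => ?_⟩
  · have heven := SplineSymbol.F_even p (SplineSymbol.rhoCrit p) 0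
    have hderiv := SplineSymbol.deriv_F_pi p (SplineSymbol.rhoCrit p) 0
    have hderiv2 := (SplineSymbol.iteratedDeriv_two_F_rhoCrit_pi_pos hp).ne'
    rintro θ (rfl | rfl)
    · rw [SplineSymbol.deriv_neg_of_even heven, SplineSymbol.iteratedDeriv_neg_of_even 2 heven,
        even_two.neg_one_pow, one_smul]
      exact ⟨neg_eq_zero.2 hderiv, hderiv2⟩
    · exact ⟨hderiv, hderiv2⟩
  · exact (SplineSymbol.strictAntiOn_normalizedF hp
      (mul_nonpos_of_nonneg_of_nonpos hρ.le hδ)).mono Set.Ioo_subset_Icc_self
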